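/- Let $(\Omega,\mathcal F,\mathbb P)$ be a probability space. A random variable $X$ is *super-Pareto* if it has the same distribution as $f(Y)$ for some increasing (in the non-strict sense), convex and non-constant function $f:[1,\infty)\to\mathbb R$ and $Y\sim\mathrm{Pareto}(1)$, i.e. $\mathbb P(Y\le y)=1-1/y$ for $y\ge 1$. Random variables $X_1,\dots,X_n$ are *weakly negatively associated* if for every $i$, every (Borel) set $S\subseteq\mathbb R^{n-1}$ that is decreasing ($\mathbf x\in S$ and $\mathbf y\le\mathbf x$ imply $\mathbf y\in S$), and every $x\in\mathbb R$ with $\mathbb P(X_i\le x)>0$, one has $\mathbb P(\mathbf X_{-i}\in S\mid X_i\le x)\le\mathbb P(\mathbf X_{-i}\in S)$, where $\mathbf X_{-i}=(X_j)_{j\ne i}$. Write $z_X=\operatorname{ess\,inf}X=\sup\{x:\mathbb P(X\le x)=0\}$, and for $p\in(0,1)$ write $\mathrm{VaR}_p(X)=\inf\{t\in\mathbb R:\mathbb P(X\le t)\ge p\}$. **Theorem.** Let $X$ be a super-Pareto random variable with $z_X\ge 0$ (a non-negative loss), let $X_1,\dots,X_n$ be weakly negatively associated random variables, each with the same distribution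 as $X$, and let $Y_i=\min\{X_i,c_i\}$, where $c_i\ge z_X$ for each $i$. Let $(\theta_1,\dots,\theta_n)\in[0,1]^n$ satisfy $\sum_{i=1}^n\theta_i=1$ and $\theta_i>0$ for at least two indices $i$, and put $c=\min\{c_1\theta_1,\dots,c_n\theta_n\}$. 1. For every $t\in(z_X,c]$ and every $i\in\{1,\dots,n\}$, $$\mathbb P\Big(\sum_{j=1}^n\theta_jY_j>t\Big)=\mathbb P\Big(\sum_{j=1}^n\theta_jX_j>t\Big)>\mathbb P(X>t)=\mathbb P(Y_i>t),$$ where the first equality is claimed for $t<c$, and also for $t=c$ provided that $\mathbb P(X=0)=0$; the strict inequality and the last equality hold for all $t\in(z_X,c]$ without this proviso. 2. For every $p\in(0,\mathbb P(X\le c))$ with $p\ge\mathbb P(X=z_X)$, $$\mathrm{VaR}_p\Big(\sum_{i=1}^n\theta_iY_i\Big)>\sum_{i=1}^n\theta_i\,\mathrm{VaR}_p(Y_i).$$ In particular, if $X$ has no atom at $z_X$, the full chain holds for all $t\in(z_X,c]$ and the VaR inequality for all $p\in(0,\mathbb P(X\le c))$. -/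

import Mathlib

open MeasureTheory ProbabilityTheory

/-- A random variable `X` is super-Pareto if it has the same distribution as `f(Y)` for some
increasing, convex, non-constant function `f` on `[1, ∞)`, where `Y ∼ Pareto(1)`, that is
`P(Y ≤ y) = 1 - 1 / y` for `y ≥ 1` (Pareto law with scale `1` and shape `1`). -/
def IsSuperPareto {Ω : Type*} [MeasurableSpace Ω] (μ : Measure Ω) (X : Ω → ℝ) : Prop :=
  ∃ f : ℝ → ℝ, MonotoneOn f (Set.Ici 1) ∧ ConvexOn ℝ (Set.Ici 1) f ∧
    (∃ x ∈ Set.Ici (1 : ℝ), ∃ y ∈ Set.Ici (1 : ℝ), f x ≠ f y) ∧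
    IdentDistrib X f μ (paretoMeasure 1 1)

/-- Weak negative association: for every index `i`, every decreasing (Borel) set `S` of vectors
indexed by the other indices, and every `x` with `P(X_i ≤ x) > 0`,
`P(X_{-i} ∈ S | X_i ≤ x) ≤ P(X_{-i} ∈ S)`. -/
def WeaklyNegAssoc {Ω : Type*} [MeasurableSpace Ω] (μ : Measure Ω) {n : ℕ}
    (X : Fin n → Ω → ℝ) : Prop :=
  ∀ (i : Fin n) (S : Set ({j : Fin n // j ≠ i} → ℝ)), MeasurableSet S → IsLowerSet S →
    ∀ x : ℝ, 0 < μ {ω | X i ω ≤ x} →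
      cond μ {ω | X i ω ≤ x} {ω | (fun j : {j : Fin n // j ≠ i} => X j ω) ∈ S} ≤
        μ {ω | (fun j : {j : Fin n // j ≠ i} => X j ω) ∈ S}

/-- Value-at-Risk at level `p`: the left quantile `inf {t | P(X ≤ t) ≥ p}`
(meaningful for `p ∈ (0, 1)`). -/
noncomputable def VaR {Ω : Type*} [MeasurableSpace Ω] (μ : Measure Ω) (p : ℝ) (X : Ω → ℝ) : ℝ :=
  sInf {t : ℝ | p ≤ μ.real {ω | X ω ≤ t}}

/-! Everything rests on P(∑ θ_k X_k ≤ t) < P(X ≤ t). Let z = f 1 be the left end point and F(t) = 1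
- 1/u with f u = t. As every X_k ≥ z, the event ∑ θ_k X_k ≤ t forces X_k ≤ z + (t - z)/θ_k for all
k, and weak negative association bounds the joint probability by the product of the marginals.
Convexity of f bounds each factor by (1 + θ_k/(u - 1))⁻¹ (`IsSuperPareto.exists_real_le_bound`), and
expanding the product gives ∏ (1 + θ_k/(u - 1)) > 1 + 1/(u - 1) = 1/F(t).

Caps do not matter up to level c: a summand at its cap already contributes c_i θ_i ≥ c
(`lt_sum_mul_min_iff`). For VaR, write p = F(q) with q < c: each VaR of Y_i is at most q, while the
capped sum has distribution function below p at q, hence slightly beyond q by right continuity. -/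

section

/-! ### Pareto law and convex transforms of it -/

/-- The survival function of the Pareto law with scale `1` and shape `1`. -/
lemma paretoMeasure_one_one_real_Ioi {y : ℝ} (hy : 1 ≤ y) :
    (paretoMeasure 1 1).real (Set.Ioi y) = 1 / y := by
  have hy0 : 0 < y := by linarith
  rw [measureReal_def, paretoMeasure, withDensity_apply _ measurableSet_Ioi,
    setLIntegral_congr_fun (g := fun x : ℝ => ENNReal.ofReal (x ^ (-2 : ℝ))) measurableSet_Ioi,
    ← integral_eq_lintegral_of_nonneg_ae, integral_Ioi_rpow_of_lt (by norm_num) hy0]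
  · norm_num [Real.rpow_neg_one]
  · filter_upwards [ae_restrict_mem measurableSet_Ioi] with x hx
    exact Real.rpow_nonneg (hy0.le.trans (le_of_lt hx)) _
  · exact (measurable_id.pow_const _).aestronglyMeasurable
  · intro x hx
    simp only [paretoPDF_of_le (hy.trans (le_of_lt hx))]
    norm_num

lemma paretoMeasure_one_one_Iio : paretoMeasure 1 1 (Set.Iio 1) = 0 := by
  rw [paretoMeasure, withDensity_apply _ measurableSet_Iio, lintegral_paretoPDF_of_le le_rfl]

lemma ae_one_le_paretoMeasure_one_one : ∀ᵐ y ∂paretoMeasure 1 1, (1 : ℝ) ≤ y := by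
  rw [ae_iff]
  exact (measure_mono_null (fun y hy => not_le.1 hy) paretoMeasure_one_one_Iio)

lemma paretoMeasure_one_one_real_Iic {y : ℝ} (hy : 1 ≤ y) :
    (paretoMeasure 1 1).real (Set.Iic y) = 1 - 1 / y := by
  have := isProbabilityMeasure_paretoMeasure one_pos one_pos
  rw [← paretoMeasure_one_one_real_Ioi hy, ← Set.compl_Iic, probReal_compl_eq_one_sub measurableSet_Iic]
  ring

/-- A monotone convex function on `[a, ∞)` is continuous there, the end point included. -/
lemma MonotoneOn.continuousOn_Ici_of_convexOn {f : ℝ → ℝ} {a : ℝ}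
    (hmono : MonotoneOn f (Set.Ici a)) (hconv : ConvexOn ℝ (Set.Ici a) f) :
    ContinuousOn f (Set.Ici a) := by
  refine hconv.continuousOn_Ici ?_
  -- Convexity alone allows a jump at `a`; monotonicity squeezes `f` between `f a` and the chord
  -- over `[a, a + 1]`.
  have hlim : Filter.Tendsto (fun y => (1 - (y - a)) * f a + (y - a) * f (a + 1))
      (nhdsWithin a (Set.Ici a)) (nhds (f a)) := by
    have : Continuous fun y => (1 - (y - a)) * f a + (y - a) * f (a + 1) := by fun_prop
    exact (this.tendsto' a (f a) (by simp)).mono_left nhdsWithin_le_nhds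
  refine tendsto_of_tendsto_of_tendsto_of_le_of_le' tendsto_const_nhds hlim ?_ ?_
  · filter_upwards [self_mem_nhdsWithin] with y hy using hmono Set.self_mem_Ici hy hy
  · filter_upwards [Icc_mem_nhdsGE (lt_add_one a)] with y hy
    have h := hconv.2 (Set.mem_Ici.2 le_rfl) (Set.mem_Ici.2 (le_add_of_nonneg_right zero_le_one))
      (by linarith [hy.2] : 0 ≤ 1 - (y - a)) (by linarith [hy.1] : 0 ≤ y - a) (by ring)
    have hy' : (1 - (y - a)) • a + (y - a) • (a + 1) = y := by simp only [smul_eq_mul]; ring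
    rwa [hy'] at h

/-- A non-constant increasing convex function on `[1, ∞)` takes every value `t ≥ f 1`, and there is
a largest point at which it does so. -/
lemma exists_last_preimage {f : ℝ → ℝ} (hmono : MonotoneOn f (Set.Ici 1))
    (hconv : ConvexOn ℝ (Set.Ici 1) f)
    (hne : ∃ x ∈ Set.Ici (1 : ℝ), ∃ y ∈ Set.Ici (1 : ℝ), f x ≠ f y) {t : ℝ} (ht : f 1 ≤ t) :
    ∃ u, 1 ≤ u ∧ f u = t ∧ ∀ y, u < y → t < f y := by
  obtain ⟨b, hb, hfb⟩ : ∃ b, 1 < b ∧ f 1 < f b := by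
    by_contra! h
    have h' : ∀ x, 1 ≤ x → f x = f 1 := by
      intro x hx
      rcases hx.eq_or_lt with rfl | hx'
      · rfl
      · exact le_antisymm (h x hx') (hmono (by simp) hx hx)
    obtain ⟨x, hx, y, hy, hxy⟩ := hne
    exact hxy ((h' x hx).trans (h' y hy).symm)
  -- the chord from `1` to `b` bounds `f` from below beyond `b`
  have hchord : ∀ y, b < y → f 1 + (f b - f 1) / (b - 1) * (y - 1) ≤ f y := by
    intro y hy
    have h := hconv.secant_mono_aux1 (Set.mem_Ici.2 le_rfl) (Set.mem_Ici.2 (hb.trans hy).le) hb hy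
    have hb' : 0 < b - 1 := by linarith
    rw [div_mul_eq_mul_div, ← le_sub_iff_add_le', div_le_iff₀ hb']
    nlinarith
  set m := (f b - f 1) / (b - 1) with hm
  have hm0 : 0 < m := div_pos (by linarith) (by linarith)
  -- At `B` the chord line has height at least `t + 1`.
  set B := max (b + 1) (1 + (t - f 1 + 1) / m) with hB
  have hBb : b < B := lt_of_lt_of_le (by linarith) (le_max_left _ _)
  have hfB : t < f B := by
    have h1 := hchord B hBb
    have h2 : (t - f 1 + 1) / m ≤ B - 1 := by linarith [le_max_right (b + 1) (1 + (t - f 1 + 1) / m)]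
    rw [div_le_iff₀ hm0] at h2
    linarith [mul_comm m (B - 1)]
  have hcont : ContinuousOn f (Set.Ici 1) := hmono.continuousOn_Ici_of_convexOn hconv
  set A := {y | y ∈ Set.Icc 1 B ∧ f y = t} with hA
  have hIcc : Set.Icc 1 B ⊆ Set.Ici (1 : ℝ) := fun x hx => hx.1
  have hAc : IsCompact A := by
    have : IsClosed A := (hcont.mono hIcc).preimage_isClosed_of_isClosed isClosed_Icc
      (isClosed_singleton (x := t))
    exact isCompact_Icc.of_isClosed_subset this fun x hx => hx.1
  have hAne : A.Nonempty := by
    obtain ⟨y, hy, hy'⟩ := intermediate_value_Icc (hb.trans hBb).le (hcont.mono hIcc) ⟨ht, hfB.le⟩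
    exact ⟨y, hy, hy'⟩
  obtain ⟨u, ⟨⟨hu1, huB⟩, hut⟩, hmax⟩ := hAc.exists_isGreatest hAne
  refine ⟨u, hu1, hut, fun y hy => ?_⟩
  refine lt_of_le_of_ne (hut ▸ hmono hu1 (hu1.trans hy.le) hy.le) fun h => ?_
  rcases le_total y B with hyB | hyB
  · exact absurd (hmax ⟨⟨hu1.trans hy.le, hyB⟩, h.symm⟩) (not_le.2 hy)
  · exact absurd (hmono (hb.trans hBb).le (hu1.trans hy.le) hyB) (by rw [← h]; exact not_le.2 hfB)

variable {Ω : Type*} [MeasurableSpace Ω] {μ : Measure Ω} {X : Ω → ℝ} {f : ℝ → ℝ}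

/-- Pareto(1) charges every `[1, w]` with `w > 1`, so by continuity at 1 values arbitrarily close to
`f 1` have positive probability. -/
lemma ProbabilityTheory.IdentDistrib.essInf_eq_apply_one
    (hmono : MonotoneOn f (Set.Ici 1)) (hcont : ContinuousOn f (Set.Ici 1))
    (h : IdentDistrib X f μ (paretoMeasure 1 1)) : essInf X μ = f 1 := by
  have hset : {a | μ {ω | X ω < a} = 0} = Set.Iic (f 1) := by
    ext a
    have hm : μ {ω | X ω < a} = paretoMeasure 1 1 {y | f y < a} := h.measure_mem_eq measurableSet_Iio
    simp only [Set.mem_ofPred_eq, Set.mem_Iic, hm]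
    constructor
    · intro h0
      by_contra! hlt
      have hev : ∀ᶠ y in nhdsWithin 1 (Set.Ici 1), f y < a :=
        (hcont 1 Set.self_mem_Ici).eventually (gt_mem_nhds hlt)
      obtain ⟨w, hw, hsub⟩ := mem_nhdsGE_iff_exists_Icc_subset.1 hev
      have hw1 : 1 < w := hw
      have := isProbabilityMeasure_paretoMeasure one_pos one_pos
      have hle : (paretoMeasure 1 1).real (Set.Iic w) ≤ 0 := by
        have : paretoMeasure 1 1 (Set.Iic w) ≤ 0 := by
          rw [← h0]
          refine measure_mono_ae ?_
          filter_upwards [ae_one_le_paretoMeasure_one_one] with y hy hyw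
          exact hsub ⟨hy, hyw⟩
        simp [measureReal_def, le_antisymm this bot_le]
      rw [paretoMeasure_one_one_real_Iic hw1.le] at hle
      have : 1 / w < 1 := (div_lt_one (by linarith)).2 hw1
      linarith
    · intro ha
      refine measure_mono_null (fun y hy => ?_) paretoMeasure_one_one_Iio
      by_contra! hy1
      have hy1 : 1 ≤ y := by simpa using hy1
      have : f y < a := hy
      linarith [hmono Set.self_mem_Ici hy1 hy1]
  rw [essInf_eq_sSup, hset, csSup_Iic]

/-- The distribution function of `f(Y)`, `Y ∼ Pareto(1)`, at a value `f u` that `f` exceeds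
beyond `u`. -/
lemma ProbabilityTheory.IdentDistrib.real_le_apply (hmono : MonotoneOn f (Set.Ici 1))
    (h : IdentDistrib X f μ (paretoMeasure 1 1)) {u : ℝ} (hu : 1 ≤ u)
    (hlt : ∀ y, u < y → f u < f y) : μ.real {ω | X ω ≤ f u} = 1 - 1 / u := by
  have hm : μ {ω | X ω ≤ f u} = paretoMeasure 1 1 {y | f y ≤ f u} :=
    h.measure_mem_eq measurableSet_Iic
  rw [← paretoMeasure_one_one_real_Iic hu, measureReal_def, measureReal_def, hm]
  congr 1
  refine measure_congr (Filter.eventuallyEq_set.2 ?_)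
  filter_upwards [ae_one_le_paretoMeasure_one_one] with y hy
  exact ⟨fun h' => not_lt.1 fun h'' => not_lt.2 h' (hlt y h''), fun h' => hmono hy hu h'⟩

/-- For a super-Pareto variable with distribution function `F` and left end point `z`, and any
`t ≥ z` with `F t > 0`: `0 < F t < 1` and `F (z + (t - z) / r) ≤ (u - 1) / (u - 1 + r)`, where
`F t = 1 - 1 / u`. -/
lemma IsSuperPareto.exists_real_le_bound (hsp : IsSuperPareto μ X) {t : ℝ}
    (ht : essInf X μ ≤ t) :
    ∃ u, 1 ≤ u ∧ μ.real {ω | X ω ≤ t} = 1 - 1 / u ∧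
      (essInf X μ < t → 1 < u) ∧
      ∀ r, 0 < r → r ≤ 1 → 1 < u →
        μ.real {ω | X ω ≤ essInf X μ + (t - essInf X μ) / r} ≤ (u - 1) / (u - 1 + r) := by
  obtain ⟨f, hmono, hconv, hne, hid⟩ := hsp
  have hcont : ContinuousOn f (Set.Ici 1) := hmono.continuousOn_Ici_of_convexOn hconv
  rw [hid.essInf_eq_apply_one hmono hcont] at ht ⊢
  obtain ⟨u, hu, rfl, hlt⟩ := exists_last_preimage hmono hconv hne ht
  refine ⟨u, hu, hid.real_le_apply hmono hu hlt, fun h => ?_, fun r hr hr1 hu1 => ?_⟩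
  · exact lt_of_le_of_ne hu fun h' => absurd h (by simp [← h'])
  -- Chosen so that `u` is the convex combination `(1 - r) * 1 + r * v`.
  set v := 1 + (u - 1) / r with hv
  have huv : u ≤ v := by
    have : u - 1 ≤ (u - 1) / r := le_div_self (by linarith) hr hr1
    linarith
  have hv1 : 1 ≤ v := hu.trans huv
  have hfv : f 1 + (f u - f 1) / r ≤ f v := by
    have h := hconv.2 (Set.mem_Ici.2 le_rfl) (Set.mem_Ici.2 hv1) (sub_nonneg.2 hr1) hr.le
      (by ring : (1 - r) + r = 1)
    have hu' : (1 - r) • (1 : ℝ) + r • v = u := by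
      simp only [smul_eq_mul, hv]; field_simp; ring
    rw [hu'] at h
    simp only [smul_eq_mul] at h
    rw [← le_sub_iff_add_le', div_le_iff₀ hr]
    linarith
  have hm : μ.real {ω | X ω ≤ f 1 + (f u - f 1) / r} ≤ (paretoMeasure 1 1).real (Set.Iic v) := by
    have := isProbabilityMeasure_paretoMeasure one_pos one_pos
    have hm : μ {ω | X ω ≤ f 1 + (f u - f 1) / r} =
        paretoMeasure 1 1 {y | f y ≤ f 1 + (f u - f 1) / r} := hid.measure_mem_eq measurableSet_Iic
    rw [measureReal_def, hm]
    refine measureReal_mono (fun y hy => ?_)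
    by_contra! hvy
    have hvy : v < y := by simpa using hvy
    have h1 : f y ≤ f 1 + (f u - f 1) / r := hy
    -- a convex function increasing strictly beyond `u` is injective there
    have h2 : f y = f v := le_antisymm (h1.trans hfv) (hmono hv1 (hv1.trans hvy.le) hvy.le)
    have h3 := hlt y (huv.trans_lt hvy)
    rcases huv.eq_or_lt with h4 | h4
    · rw [← h4] at h2; linarith
    · have := hconv.lt_right_of_left_lt (Set.mem_Ici.2 hu) (Set.mem_Ici.2 (hv1.trans hvy.le))
        (x := u) (z := v) (y := y) ?_ (hlt v h4)
      · linarith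
      · rw [openSegment_eq_Ioo (h4.trans hvy)]; exact ⟨h4, hvy⟩
  refine hm.trans_eq ?_
  rw [paretoMeasure_one_one_real_Iic hv1]
  have : 0 < u - 1 + r := by linarith
  have hv' : v = (u - 1 + r) / r := by rw [hv]; field_simp; ring
  rw [hv']
  field_simp
  ring

end

/-! ### Strict comparison of the weighted sum with one variable -/

section

/-- Weak negative association implies negative lower orthant dependence. -/
lemma WeaklyNegAssoc.real_forall_le_le_prod {Ω : Type*} [MeasurableSpace Ω] {μ : Measure Ω}
    [IsProbabilityMeasure μ] {n : ℕ} {X : Fin n → Ω → ℝ} (hwna : WeaklyNegAssoc μ X)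
    (hX : ∀ i, Measurable (X i)) (x : Fin n → ℝ) (A : Finset (Fin n)) :
    μ.real {ω | ∀ i ∈ A, X i ω ≤ x i} ≤ ∏ i ∈ A, μ.real {ω | X i ω ≤ x i} := by
  classical
  induction A using Finset.induction_on with
  | empty => simp
  | insert i A hi ih =>
    rw [Finset.prod_insert hi]
    have hmi : MeasurableSet {ω | X i ω ≤ x i} := measurableSet_le (hX i) measurable_const
    have hinter : {ω | ∀ j ∈ insert i A, X j ω ≤ x j} =
        {ω | X i ω ≤ x i} ∩ {ω | ∀ j ∈ A, X j ω ≤ x j} := by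
      ext ω; simp
    rw [hinter]
    rcases eq_or_ne (μ {ω | X i ω ≤ x i}) 0 with h0 | h0
    · rw [measureReal_def, measure_inter_null_of_null_left _ h0]
      simp [measureReal_def, h0]
    set S : Set ({j : Fin n // j ≠ i} → ℝ) := {y | ∀ j : {j : Fin n // j ≠ i}, j.1 ∈ A → y j ≤ x j}
      with hS
    have hSm : MeasurableSet S := by
      have : S = ⋂ j : {j : Fin n // j ≠ i}, ⋂ (_ : j.1 ∈ A), {y | y j ≤ x j} := by
        ext y; simp [hS]
      rw [this]
      exact MeasurableSet.iInter fun j => MeasurableSet.iInter fun _ =>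
        measurableSet_le (measurable_pi_apply j) measurable_const
    have hSl : IsLowerSet S := fun y y' hy h j hj => (hy j).trans (h j hj)
    have hpre : {ω | (fun j : {j : Fin n // j ≠ i} => X j ω) ∈ S} = {ω | ∀ j ∈ A, X j ω ≤ x j} := by
      ext ω
      exact ⟨fun h j hj => h ⟨j, fun hji => hi (hji ▸ hj)⟩ hj, fun h j hj => h j.1 hj⟩
    have key := hwna i S hSm hSl (x i) (pos_iff_ne_zero.2 h0)
    rw [hpre, cond_apply hmi] at key
    have key' := ENNReal.toReal_mono (measure_ne_top _ _) key
    rw [ENNReal.toReal_mul, ENNReal.toReal_inv, ← measureReal_def, ← measureReal_def,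
      ← measureReal_def] at key'
    have hpos : 0 < μ.real {ω | X i ω ≤ x i} := ENNReal.toReal_pos h0 (measure_ne_top _ _)
    rw [inv_mul_le_iff₀ hpos] at key'
    exact key'.trans (mul_le_mul_of_nonneg_left ih hpos.le)

lemma one_add_sum_le_prod_one_add {ι : Type*} (s : Finset ι) {a : ι → ℝ} (ha : ∀ i, 0 ≤ a i) :
    1 + ∑ k ∈ s, a k ≤ ∏ k ∈ s, (1 + a k) := by
  classical
  induction s using Finset.induction_on with
  | empty => simp
  | insert i s hi ih =>
    rw [Finset.sum_insert hi, Finset.prod_insert hi]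
    nlinarith [ha i, mul_nonneg (ha i) (Finset.sum_nonneg fun k (_ : k ∈ s) => ha k)]

/-- Strictness comes from the cross terms of the expansion, such as `a i * a j`. -/
lemma one_add_sum_lt_prod_one_add {ι : Type*} [Fintype ι] {a : ι → ℝ} (ha : ∀ i, 0 < a i)
    {i j : ι} (hij : i ≠ j) : 1 + ∑ k, a k < ∏ k, (1 + a k) := by
  classical
  have hj : j ∈ Finset.univ.erase i := by simp [hij.symm]
  have h1 : 1 + ∑ k ∈ Finset.univ.erase i, a k ≤ ∏ k ∈ Finset.univ.erase i, (1 + a k) :=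
    one_add_sum_le_prod_one_add _ fun k => (ha k).le
  have h2 : 0 < ∑ k ∈ Finset.univ.erase i, a k := Finset.sum_pos (fun k _ => ha k) ⟨j, hj⟩
  rw [← Finset.add_sum_erase _ _ (Finset.mem_univ i), ← Finset.mul_prod_erase _ _ (Finset.mem_univ i)]
  nlinarith [ha i, mul_pos (ha i) h2]

variable {Ω : Type*} [MeasurableSpace Ω] {μ : Measure Ω} {X : Ω → ℝ}

lemma IsSuperPareto.ae_essInf_le (hsp : IsSuperPareto μ X) : ∀ᵐ ω ∂μ, essInf X μ ≤ X ω := by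
  obtain ⟨f, hmono, hconv, -, hid⟩ := hsp
  rw [hid.essInf_eq_apply_one hmono (hmono.continuousOn_Ici_of_convexOn hconv)]
  refine hid.symm.ae_mem_snd measurableSet_Ici ?_
  filter_upwards [ae_one_le_paretoMeasure_one_one] with y hy using hmono Set.self_mem_Ici hy hy

variable [IsProbabilityMeasure μ]

/-- A weighted sum of weakly negatively associated super-Pareto variables is strictly less likely
than one of them to be at most `t`. -/
lemma IsSuperPareto.real_sum_le_lt (hsp : IsSuperPareto μ X) {n : ℕ} {Xs : Fin n → Ω → ℝ}
    {θ : Fin n → ℝ} (hXs : ∀ i, Measurable (Xs i)) (hident : ∀ i, IdentDistrib (Xs i) X μ μ)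
    (hwna : WeaklyNegAssoc μ Xs) (hθ : ∀ i, 0 < θ i) (hsum : ∑ i, θ i = 1)
    {i j : Fin n} (hij : i ≠ j) {t : ℝ} (ht : essInf X μ ≤ t) (ht0 : 0 < μ.real {ω | X ω ≤ t}) :
    μ.real {ω | ∑ i, θ i * Xs i ω ≤ t} < μ.real {ω | X ω ≤ t} := by
  obtain ⟨u, hu, hFt, -, hbound⟩ := hsp.exists_real_le_bound ht
  set z := essInf X μ with hz
  have hu1 : 1 < u := by
    refine lt_of_le_of_ne hu fun h => ?_
    rw [hFt, ← h] at ht0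
    norm_num at ht0
  have hge : ∀ᵐ ω ∂μ, ∀ k, z ≤ Xs k ω :=
    ae_all_iff.2 fun k => (hident k).symm.ae_mem_snd measurableSet_Ici hsp.ae_essInf_le
  have hsub : μ.real {ω | ∑ i, θ i * Xs i ω ≤ t} ≤
      μ.real {ω | ∀ k ∈ Finset.univ, Xs k ω ≤ z + (t - z) / θ k} := by
    refine ENNReal.toReal_mono (measure_ne_top _ _) (measure_mono_ae ?_)
    filter_upwards [hge] with ω hω hle k _
    have hle : ∑ i, θ i * Xs i ω ≤ t := hle
    have h1 : θ k * (Xs k ω - z) ≤ ∑ i, θ i * (Xs i ω - z) :=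
      Finset.single_le_sum (f := fun i => θ i * (Xs i ω - z))
        (fun i _ => mul_nonneg (hθ i).le (sub_nonneg.2 (hω i))) (Finset.mem_univ k)
    have h2 : ∑ i, θ i * (Xs i ω - z) = ∑ i, θ i * Xs i ω - z := by
      simp only [mul_sub, Finset.sum_sub_distrib, ← Finset.sum_mul, hsum, one_mul]
    rw [← sub_le_iff_le_add', le_div_iff₀ (hθ k)]
    linarith
  have hF : ∀ k x, μ.real {ω | Xs k ω ≤ x} = μ.real {ω | X ω ≤ x} := fun k x => by
    rw [measureReal_def, measureReal_def]
    exact congrArg _ ((hident k).measure_mem_eq measurableSet_Iic)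
  have hprod : ∏ k, μ.real {ω | Xs k ω ≤ z + (t - z) / θ k} ≤ ∏ k, (1 + θ k / (u - 1))⁻¹ := by
    refine Finset.prod_le_prod (fun _ _ => measureReal_nonneg) fun k _ => ?_
    rw [hF]
    have hk1 : θ k ≤ 1 := hsum ▸ Finset.single_le_sum (fun i _ => (hθ i).le) (Finset.mem_univ k)
    refine (hbound (θ k) (hθ k) hk1 hu1).trans_eq ?_
    have : u - 1 ≠ 0 := by linarith
    rw [← inv_inj, inv_inv, inv_div, add_div, div_self this]
  refine (hsub.trans ((hwna.real_forall_le_le_prod hXs _ _).trans hprod)).trans_lt ?_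
  have hpos : 0 < u - 1 := by linarith
  have := one_add_sum_lt_prod_one_add (fun k => div_pos (hθ k) hpos) hij
  rw [← Finset.sum_div, hsum] at this
  have h3 : (0 : ℝ) < 1 + 1 / (u - 1) := by positivity
  rw [hFt, Finset.prod_inv_distrib]
  refine (inv_strictAnti₀ h3 this).trans_eq ?_
  field_simp
  ring

/-- The distribution function of a super-Pareto variable takes every value `p < 1` with
`P(X = z) ≤ p`. -/
lemma IsSuperPareto.exists_real_le_eq (hsp : IsSuperPareto μ X) {p : ℝ} (hp0 : 0 < p) (hp1 : p < 1)
    (hp : μ.real {ω | X ω = essInf X μ} ≤ p) :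
    ∃ q, essInf X μ ≤ q ∧ μ.real {ω | X ω ≤ q} = p := by
  have hz : μ.real {ω | X ω ≤ essInf X μ} ≤ p := by
    refine le_trans (ENNReal.toReal_mono (measure_ne_top _ _) (measure_mono_ae ?_)) hp
    filter_upwards [hsp.ae_essInf_le] with ω h1 h2 using le_antisymm h2 h1
  obtain ⟨f, hmono, hconv, hne, hid⟩ := hsp
  have hcont := hmono.continuousOn_Ici_of_convexOn hconv
  rw [hid.essInf_eq_apply_one hmono hcont] at hz ⊢
  have hp' : 0 < 1 - p := by linarith
  -- The Pareto quantile at level `p`, so `f w` is the candidate for `q`.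
  set w := 1 / (1 - p) with hw
  have hw1 : 1 ≤ w := by rw [hw, le_div_iff₀ hp']; linarith
  have hmw := hmono Set.self_mem_Ici hw1 hw1
  obtain ⟨u, hu, hfu, hlt⟩ := exists_last_preimage hmono hconv hne hmw
  have hwu : w ≤ u := not_lt.1 fun h => lt_irrefl _ (hlt w h)
  have hFu : μ.real {ω | X ω ≤ f w} = 1 - 1 / u := by
    rw [← hfu]; exact hid.real_le_apply hmono hu fun y hy => hfu ▸ hlt y hy
  refine ⟨f w, hmw, ?_⟩
  have hpw : p = 1 - 1 / w := by rw [hw, one_div_one_div]; ring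
  have hw0 : 0 < w := by linarith
  have hge : p ≤ 1 - 1 / u := by
    have := one_div_le_one_div_of_le hw0 hwu
    linarith
  -- If `f w = f 1`, the atom hypothesis gives the missing bound; otherwise `f` has already risen
  -- before `w` and, by convexity, cannot be flat from `w` to `u`.
  rcases hmw.eq_or_lt with h1 | h1
  · rw [← h1] at hFu ⊢
    exact le_antisymm hz (hFu ▸ hge)
  · rcases hwu.eq_or_lt with h2 | h2
    · rw [hFu, ← h2, hpw]
    · exfalso
      have h4 : 1 < w := lt_of_le_of_ne hw1 fun h => by simp [← h] at h1
      have := hconv.lt_right_of_left_lt (Set.mem_Ici.2 le_rfl) (Set.mem_Ici.2 hu)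
        (x := 1) (z := w) (y := u) ?_ h1
      · linarith
      · rw [openSegment_eq_Ioo (h4.trans h2)]; exact ⟨h4, h2⟩

end

/-! ### Caps and Value-at-Risk -/

section

/-- Below the smallest weighted cap, capping the summands does not change whether the weighted sum
exceeds `t`. -/
lemma lt_sum_mul_min_iff {ι : Type*} [Fintype ι] {θ x b : ι → ℝ} {c t : ℝ} (hθ : ∀ i, 0 < θ i)
    (hx : ∀ i, 0 ≤ x i) (hb : ∀ i, 0 < b i) (hcb : ∀ i, c ≤ b i * θ i) (htc : t ≤ c)
    (hpos : t < c ∨ ∀ i, 0 < x i) (hcard : Nontrivial ι) :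
    t < ∑ i, θ i * min (x i) (b i) ↔ t < ∑ i, θ i * x i := by
  classical
  constructor
  · exact fun h => h.trans_le (Finset.sum_le_sum fun i _ =>
      mul_le_mul_of_nonneg_left (min_le_left _ _) (hθ i).le)
  · intro h
    by_cases hall : ∀ i, x i ≤ b i
    · simpa only [fun i => min_eq_left (hall i)] using h
    push Not at hall
    obtain ⟨i, hi⟩ := hall
    obtain ⟨j, hj⟩ := exists_ne i
    rw [← Finset.add_sum_erase _ _ (Finset.mem_univ i), min_eq_right hi.le, mul_comm]
    have hnn : ∀ k, 0 ≤ θ k * min (x k) (b k) := fun k =>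
      mul_nonneg (hθ k).le (le_min (hx k) (hb k).le)
    -- The capped term `i` reaches `c`; when `t = c`, strictness needs the positive term `j`.
    rcases hpos with hlt | hpos
    · have := Finset.sum_nonneg fun k (_ : k ∈ Finset.univ.erase i) => hnn k
      linarith [hcb i]
    · have := Finset.single_le_sum (f := fun k => θ k * min (x k) (b k)) (fun k _ => hnn k)
        (Finset.mem_erase.2 ⟨hj, Finset.mem_univ j⟩)
      have h2 : 0 < θ j * min (x j) (b j) := mul_pos (hθ j) (lt_min (hpos j) (hb j))
      linarith [hcb i]

variable {Ω : Type*} [MeasurableSpace Ω] {μ : Measure Ω} [IsProbabilityMeasure μ]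

lemma real_setOf_lt_eq_one_sub {Z : Ω → ℝ} (hZ : Measurable Z) (t : ℝ) :
    μ.real {ω | t < Z ω} = 1 - μ.real {ω | Z ω ≤ t} := by
  rw [← probReal_compl_eq_one_sub (measurableSet_le hZ measurable_const)]
  congr 1
  ext ω
  simp

/-- Right continuity keeps the distribution function below `p` up to some `r > q`. `p < 1` makes the
set nonempty, avoiding the default `sInf ∅ = 0`. -/
lemma lt_VaR_of_real_le_lt {Z : Ω → ℝ} (hZ : Measurable Z) {p q : ℝ} (hp : p < 1)
    (h : μ.real {ω | Z ω ≤ q} < p) : q < VaR μ p Z := by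
  have := Measure.isProbabilityMeasure_map (μ := μ) hZ.aemeasurable
  have hcdf : ∀ t, cdf (μ.map Z) t = μ.real {ω | Z ω ≤ t} := fun t => by
    rw [cdf_eq_real, map_measureReal_apply hZ measurableSet_Iic]
    rfl
  rw [← hcdf] at h
  have hev := ((cdf (μ.map Z)).right_continuous q).eventually (gt_mem_nhds h)
  obtain ⟨r, hr, hsub⟩ := mem_nhdsGE_iff_exists_Icc_subset.1 hev
  have hr' : q < r := hr
  refine hr'.trans_le (le_csInf ?_ fun t ht => ?_)
  · obtain ⟨t, ht⟩ := ((tendsto_cdf_atTop (μ.map Z)).eventually (lt_mem_nhds hp)).exists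
    exact ⟨t, by rw [Set.mem_ofPred_eq, ← hcdf]; exact ht.le⟩
  · by_contra! hlt
    have h1 : cdf (μ.map Z) r < p := hsub ⟨hr'.le, le_rfl⟩
    have h2 : p ≤ μ.real {ω | Z ω ≤ t} := ht
    rw [← hcdf] at h2
    linarith [monotone_cdf (μ.map Z) hlt.le]

/-- `0 < p` bounds the set below, as `csInf_le` requires. -/
lemma VaR_le_of_le_real {Z : Ω → ℝ} (hZ : Measurable Z) {p q : ℝ} (hp : 0 < p)
    (h : p ≤ μ.real {ω | Z ω ≤ q}) : VaR μ p Z ≤ q := by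
  have := Measure.isProbabilityMeasure_map (μ := μ) hZ.aemeasurable
  have hcdf : ∀ t, cdf (μ.map Z) t = μ.real {ω | Z ω ≤ t} := fun t => by
    rw [cdf_eq_real, map_measureReal_apply hZ measurableSet_Iic]
    rfl
  refine csInf_le ?_ h
  obtain ⟨t, ht⟩ := ((tendsto_cdf_atBot (μ.map Z)).eventually (gt_mem_nhds hp)).exists
  refine ⟨t, fun s hs => ?_⟩
  by_contra! hlt
  have h2 : p ≤ μ.real {ω | Z ω ≤ s} := hs
  rw [← hcdf] at h2
  linarith [monotone_cdf (μ.map Z) hlt.le]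

end

theorem mainTheorem5 {Ω : Type*} [MeasurableSpace Ω] (μ : Measure Ω) [IsProbabilityMeasure μ]
    {n : ℕ} (X : Ω → ℝ) (Xs Ys : Fin n → Ω → ℝ) (θ cs : Fin n → ℝ) (c : ℝ)
    (hX : Measurable X) (hXs : ∀ i, Measurable (Xs i))
    (hsp : IsSuperPareto μ X)
    (hident : ∀ i, IdentDistrib (Xs i) X μ μ)
    (hwna : WeaklyNegAssoc μ Xs)
    (hnonneg : 0 ≤ essInf X μ)
    (hcs : ∀ i, essInf X μ ≤ cs i)
    (hYs : ∀ i ω, Ys i ω = min (Xs i ω) (cs i))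
    (hθ : θ ∈ stdSimplex ℝ (Fin n))
    (hθpos : ∃ i j, i ≠ j ∧ 0 < θ i ∧ 0 < θ j)
    (hc : IsLeast (Set.range fun i => cs i * θ i) c) :
    (∀ t : ℝ, essInf X μ < t → t ≤ c →
      ((t < c ∨ μ {ω | X ω = 0} = 0) →
        μ.real {ω | t < ∑ i, θ i * Ys i ω} = μ.real {ω | t < ∑ i, θ i * Xs i ω}) ∧
      μ.real {ω | t < X ω} < μ.real {ω | t < ∑ i, θ i * Xs i ω} ∧
      ∀ i, μ.real {ω | t < X ω} = μ.real {ω | t < Ys i ω}) ∧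
    (∀ p : ℝ, 0 < p → p < μ.real {ω | X ω ≤ c} → μ.real {ω | X ω = essInf X μ} ≤ p →
      ∑ i, θ i * VaR μ p (Ys i) < VaR μ p (fun ω => ∑ i, θ i * Ys i ω)) := by
  obtain ⟨i₀, j₀, hij, -, -⟩ := hθpos
  have hnt : Nontrivial (Fin n) := ⟨i₀, j₀, hij⟩
  have hθsum := hθ.2
  have hcle : ∀ i, c ≤ cs i * θ i := fun i => hc.2 ⟨i, rfl⟩
  -- A zero weight would force `c ≤ 0`, so `c > z ≥ 0` makes all weights positive.
  have hpos : essInf X μ < c → ∀ i, 0 < θ i ∧ 0 < cs i := fun hzc i => by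
    have h : 0 < cs i * θ i := (hnonneg.trans_lt hzc).trans_le (hcle i)
    have hθi : 0 < θ i := lt_of_le_of_ne (hθ.1 i) fun h0 => by simp [← h0] at h
    exact ⟨hθi, pos_of_mul_pos_left h hθi.le⟩
  -- A second positive weight gives `θ i < 1`, hence `c ≤ cs i * θ i < cs i`.
  have hclt : essInf X μ < c → ∀ i, c < cs i := fun hzc i => by
    obtain ⟨k, hk⟩ := exists_ne i
    have h1 := Finset.add_le_sum (f := θ) (s := Finset.univ) (fun i _ => hθ.1 i)
      (Finset.mem_univ i) (Finset.mem_univ k) hk.symm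
    rw [hθsum] at h1
    have h2 := (hpos hzc k).1
    have h3 := (hpos hzc i).2
    nlinarith [hcle i]
  have hge : ∀ᵐ ω ∂μ, ∀ k, 0 ≤ Xs k ω :=
    ae_all_iff.2 fun k => (hident k).symm.ae_mem_snd measurableSet_Ici
      (hsp.ae_essInf_le.mono fun ω hω => hnonneg.trans hω)
  have hYm : ∀ i, Measurable (Ys i) := fun i => by
    rw [funext (hYs i)]
    exact (hXs i).min measurable_const
  have hsumX : Measurable fun ω => ∑ i, θ i * Xs i ω :=
    Finset.measurable_sum _ fun i _ => (hXs i).const_mul _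
  have hsumY : Measurable fun ω => ∑ i, θ i * Ys i ω :=
    Finset.measurable_sum _ fun i _ => (hYm i).const_mul _
  have hF : ∀ k x, μ.real {ω | Xs k ω ≤ x} = μ.real {ω | X ω ≤ x} := fun k x => by
    rw [measureReal_def, measureReal_def]
    exact congrArg _ ((hident k).measure_mem_eq measurableSet_Iic)
  have hsumeq : ∀ t, essInf X μ < c → t ≤ c → (t < c ∨ μ {ω | X ω = 0} = 0) →
      μ.real {ω | t < ∑ i, θ i * Ys i ω} = μ.real {ω | t < ∑ i, θ i * Xs i ω} := by
    intro t hzc htc hor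
    have hor' : ∀ᵐ ω ∂μ, t < c ∨ ∀ k, Xs k ω ≠ 0 := by
      rcases hor with h | h
      · exact Filter.Eventually.of_forall fun _ => Or.inl h
      · have : ∀ᵐ ω ∂μ, ∀ k, Xs k ω ≠ 0 := ae_all_iff.2 fun k => by
          rw [ae_iff]
          simp only [ne_eq, not_not]
          rw [← h]
          exact (hident k).measure_mem_eq (measurableSet_singleton (0 : ℝ))
        exact this.mono fun _ => Or.inr
    rw [measureReal_def, measureReal_def]
    congr 1
    refine measure_congr (Filter.eventuallyEq_set.2 ?_)
    filter_upwards [hge, hor'] with ω h0 h1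
    have := lt_sum_mul_min_iff (x := fun i => Xs i ω) (fun i => (hpos hzc i).1) h0
      (fun i => (hpos hzc i).2) hcle htc
      (h1.imp_right fun h i => lt_of_le_of_ne (h0 i) (h i).symm) hnt
    simpa only [Set.mem_ofPred_eq, hYs] using this
  refine ⟨fun t hzt htc => ⟨hsumeq t (hzt.trans_le htc) htc, ?_, fun i => ?_⟩,
    fun p hp0 hpc hpz => ?_⟩
  · have ht0 : 0 < μ.real {ω | X ω ≤ t} := by
      obtain ⟨u, -, hFt, hu, -⟩ := hsp.exists_real_le_bound hzt.le
      have := (div_lt_one (zero_lt_one.trans (hu hzt))).2 (hu hzt)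
      rw [hFt]
      linarith
    rw [real_setOf_lt_eq_one_sub hX, real_setOf_lt_eq_one_sub hsumX]
    have := hsp.real_sum_le_lt hXs hident hwna (fun i => (hpos (hzt.trans_le htc) i).1) hθsum hij
      hzt.le ht0
    linarith
  · have htci : t < cs i := htc.trans_lt (hclt (hzt.trans_le htc) i)
    simp only [hYs, lt_min_iff, htci, and_true]
    rw [real_setOf_lt_eq_one_sub hX, real_setOf_lt_eq_one_sub (hXs i), hF]
  · have hp1 : p < 1 := hpc.trans_le measureReal_le_one
    obtain ⟨q, hzq, hFq⟩ := hsp.exists_real_le_eq hp0 hp1 hpz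
    have hqc : q < c := by
      by_contra! h
      exact absurd (measureReal_mono (μ := μ) fun ω (hω : X ω ≤ c) => hω.trans h)
        (by rw [not_le]; exact hFq ▸ hpc)
    have hzc : essInf X μ < c := hzq.trans_lt hqc
    have hVi : ∀ i, VaR μ p (Ys i) ≤ q := fun i => by
      refine VaR_le_of_le_real (hYm i) hp0 ?_
      rw [← hFq, ← hF i]
      exact measureReal_mono fun ω (hω : Xs i ω ≤ q) =>
        (show Ys i ω ≤ q from hYs i ω ▸ (min_le_left _ _).trans hω)
    refine (Finset.sum_le_sum fun i _ => mul_le_mul_of_nonneg_left (hVi i) (hθ.1 i)).trans_lt ?_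
    rw [← Finset.sum_mul, hθsum, one_mul]
    refine lt_VaR_of_real_le_lt hsumY hp1 ?_
    have h1 := hsumeq q hzc hqc.le (Or.inl hqc)
    rw [real_setOf_lt_eq_one_sub hsumY, real_setOf_lt_eq_one_sub hsumX] at h1
    have h2 := hsp.real_sum_le_lt hXs hident hwna (fun i => (hpos hzc i).1) hθsum hij hzq
      (hFq ▸ hp0)
    linarith
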